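/- All logarithms are base 2, and $\{0,1\}^n$ is identified with $\mathbb{F}_2^n$. For distributions $A,B$ on a finite set $\Omega$, let $\Delta(A,B)=\frac12\sum_{x\in\Omega}|\Pr[A=x]-\Pr[B=x]|$ be their statistical distance; $A$ and $B$ are $\varepsilon'$-close if $\Delta(A,B)\le\varepsilon'$. The min-entropy of a distribution $X$ is $H_\infty(X)=\min_{x\in\mathrm{supp}(X)}\bigl(-\log\Pr[X=x]\bigr)$. Let $\mathrm{Poly}_2(n,d)$ be the set of polynomials in $\mathbb{F}_2[X_1,\dots,X_n]$ of total degree at most $d$ and of individual degrees at most $1$. A function $f:\{0,1\}^n\to\{0,1\}$ is an $\varepsilon$-extractor for a family $\mathcal{Y}$ of distributions over $\{0,1\}^n$ if for every $Y\in\mathcal{Y}$ the distribution $f(Y)$ is $\varepsilon$-close to the uniform distribution on $\{0,1\}$. **Theorem.** There is an absolute constant $n_0$ such that the following holds for every integer $n\ge n_0$ and every real $k\ge 5\log n$. Let $\mathcal{X}$ be a finite family of distributions over $\{0,1\}^n$, each of min-entropy at least $k$, let $\varepsilon'$ be a real number, and let $\mathcal{Y}$ be a (possibly infinite) family of distributions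 over $\{0,1\}^n$, each of which is $\varepsilon'$-close to a convex combination of distributions from $\mathcal{X}$. Then for every integer $d\ge 6$, a uniformly random polynomial $p\in\mathrm{Poly}_2(n,d)$ is an $\varepsilon$-extractor for $\mathcal{Y}$ with probability at least $$1-|\mathcal{X}|\cdot e^{3n-30k^{d/2}/n^2},\qquad\text{where}\quad \varepsilon=\left(\frac{2d}{k^{1/4}}\right)^d+\varepsilon'.$$ -/

import Mathlib

noncomputable section

namespace LowDegreeExtractor

/-- The cube `{0,1}^n`, identified with `F_2^n`. -/
abbrev Cube (n : ℕ) : Type := Fin n → ZMod 2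

/-- The space of all polynomials over `F_2` in `n` variables of total degree at most `d` and of
individual degrees at most `1`. -/
def Poly (n d : ℕ) : Submodule (ZMod 2) (MvPolynomial (Fin n) (ZMod 2)) :=
  MvPolynomial.restrictTotalDegree (Fin n) (ZMod 2) d ⊓
    MvPolynomial.restrictDegree (Fin n) (ZMod 2) 1

theorem mem_Poly {n d : ℕ} {p : MvPolynomial (Fin n) (ZMod 2)} :
    p ∈ Poly n d ↔ p.totalDegree ≤ d ∧ ∀ i, p.degreeOf i ≤ 1 := by
  simp only [Poly, Submodule.mem_inf, MvPolynomial.mem_restrictTotalDegree,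
    MvPolynomial.mem_restrictDegree, MvPolynomial.degreeOf_le_iff]
  exact and_congr_right fun _ => ⟨fun h i s hs => h s hs i, fun h s hs i => h i s hs⟩

/-- There are only finitely many such polynomials. -/
instance finite_Poly (n d : ℕ) : Finite (Poly n d) := by
  refine Finite.of_injective
    (fun p : Poly n d => fun x : Cube n => MvPolynomial.eval x (p : MvPolynomial _ _)) ?_
  intro p q h
  refine Subtype.ext (sub_eq_zero.mp ?_)
  refine MvPolynomial.eq_zero_of_eval_eq_zero (Fin n) (ZMod 2) _ (fun x => ?_) ?_
  · have := congrFun h x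
    simpa [sub_eq_zero] using this
  · simpa [ZMod.card] using (p - q).2.2

/-- The probability of the event `E` for a uniformly random element of `Poly n d`. -/
def probPoly (n d : ℕ) (E : MvPolynomial (Fin n) (ZMod 2) → Prop) : ℝ :=
  (Nat.card {p : Poly n d // E p} : ℝ) / (Nat.card (Poly n d) : ℝ)

/-- Statistical distance between two distributions on a finite set. -/
def statDist {α : Type*} [Fintype α] (A B : PMF α) : ℝ :=
  (1 / 2) * ∑ x, |(A x).toReal - (B x).toReal|

/-- Min-entropy: the minimum of `- log₂ Pr[X = x]` over the support of `X`. -/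
def minEntropy {α : Type*} [Fintype α] (X : PMF α) : ℝ :=
  ⨅ x : X.support, -Real.logb 2 (X (x : α)).toReal

/-- `Z` is a convex combination of distributions from `𝒳`: it samples a member of `𝒳` according
to some probability weights `w`, and then samples from that member. -/
def IsConvexCombination {α : Type*} (𝒳 : Set (PMF α)) (Z : PMF α) : Prop :=
  ∃ w : PMF (PMF α), w.support ⊆ 𝒳 ∧ Z = w.bind id

/-- `f` is an `ε`-extractor (with one output bit) for the family `𝒴`: for every source in `𝒴`, its
image under `f` is `ε`-close to a uniform bit. -/
def IsExtractor {n : ℕ} (f : Cube n → ZMod 2) (ε : ℝ) (𝒴 : Set (PMF (Cube n))) : Prop :=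
  ∀ Y ∈ 𝒴, statDist (Y.map f) (PMF.uniformOfFintype (ZMod 2)) ≤ ε

end LowDegreeExtractor

end

noncomputable section

namespace LowDegreeExtractor

open Finset

/-! Fix one source `X` of min-entropy at least `k`, and put `m = ⌊k/2⌋`. The bias of `p` on `X` is
the expectation of `(-1) ^ p(X)`; it should be at most `2ε` except with tiny probability.

The combinatorial core (`exists_interpolates_card`) is that any `2 ^ m` points of the cube contain
`m.choose d` points on which polynomials of degree at most `d` realise every function. On such a set
a random `p` is a uniformly random function, so its weighted sum of signs concentrates as in
Hoeffding's inequality.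

To use this for a non-uniform `X`, a maximal family of disjoint sets of this kind is chosen, with
probabilities constant up to a factor 2 on each (`exists_disjoint_blocks`). By maximality each
dyadic level keeps fewer than `2 ^ m` uncovered points, so the uncovered mass is at most `2 * 2 ^ m
* 2 ^ (-k)`. A union bound over the at most `2 ^ n` blocks controls `X` (`card_biased_le`), and
another one runs over `𝒳`. Passing to `𝒴` costs no further probability: bias is affine in the
source, and moves by at most twice the statistical distance. -/

/-! ### Counting integers of small binary weight -/

/-- The number of `i < N` whose binary expansion has fewer than `e` ones. -/
def lowWeightCount (e N : ℕ) : ℕ :=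
  ∑ i ∈ range N, if (Nat.digits 2 i).sum < e then 1 else 0

theorem lowWeightCount_succ_right (e N : ℕ) :
    lowWeightCount e (N + 1) =
      lowWeightCount e N + if (Nat.digits 2 N).sum < e then 1 else 0 :=
  sum_range_succ _ _

@[simp] theorem lowWeightCount_zero_left (N : ℕ) : lowWeightCount 0 N = 0 := by
  simp [lowWeightCount]

@[simp] theorem lowWeightCount_zero_right (e : ℕ) : lowWeightCount e 0 = 0 := by
  simp [lowWeightCount]

theorem lowWeightCount_one (e : ℕ) : lowWeightCount (e + 1) 1 = 1 := by
  rw [← zero_add 1, lowWeightCount_succ_right]; simp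

theorem sum_digits_two_mul (i : ℕ) : (Nat.digits 2 (2 * i)).sum = (Nat.digits 2 i).sum := by
  rcases Nat.eq_zero_or_pos i with rfl | hi
  · simp
  · have := Nat.digits_add 2 (by norm_num) 0 i (by norm_num) (Or.inr hi.ne')
    rw [zero_add] at this
    rw [this]; simp

theorem sum_digits_two_mul_add_one (i : ℕ) :
    (Nat.digits 2 (2 * i + 1)).sum = (Nat.digits 2 i).sum + 1 := by
  have := Nat.digits_add 2 (by norm_num) 1 i (by norm_num) (Or.inl one_ne_zero)
  rw [add_comm] at this
  rw [this]; simp [add_comm]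

/-- Split by the last bit: `2i` has the binary weight of `i`, and `2i + 1` has one more. -/
theorem lowWeightCount_two_mul (e N : ℕ) :
    lowWeightCount (e + 1) (2 * N) = lowWeightCount (e + 1) N + lowWeightCount e N := by
  induction N with
  | zero => simp
  | succ N ih =>
    rw [show 2 * (N + 1) = 2 * N + 1 + 1 by ring, lowWeightCount_succ_right,
      lowWeightCount_succ_right, ih, sum_digits_two_mul, sum_digits_two_mul_add_one,
      lowWeightCount_succ_right _ N, lowWeightCount_succ_right _ N]
    simp only [Nat.add_lt_add_iff_right]
    ring

theorem lowWeightCount_two_mul_add_one (e N : ℕ) :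
    lowWeightCount (e + 1) (2 * N + 1) =
      lowWeightCount (e + 1) (N + 1) + lowWeightCount e N := by
  rw [lowWeightCount_succ_right, lowWeightCount_two_mul, sum_digits_two_mul,
    lowWeightCount_succ_right _ N]
  ring

theorem lowWeightCount_exchange (e N : ℕ) :
    lowWeightCount (e + 1) N + lowWeightCount e (N + 1) ≤
      lowWeightCount (e + 1) (N + 1) + lowWeightCount e N := by
  rw [lowWeightCount_succ_right, lowWeightCount_succ_right]
  split_ifs <;> omega

/-- This is the numerical inequality that drives the induction in `exists_interpolates`, where a set
is cut into halves of sizes `a` and `b`. Equality holds for `a = b`; otherwise halve both numbers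
and induct according to parity. -/
theorem lowWeightCount_add_le (a b : ℕ) (hba : b ≤ a) (e : ℕ) :
    lowWeightCount (e + 1) (a + b) ≤ lowWeightCount (e + 1) a + lowWeightCount e b := by
  induction hs : a + b using Nat.strong_induction_on generalizing a b e with
  | _ s ih =>
  subst hs
  -- The truncated `e - 1` is harmless: for `e = 0` the left side vanishes.
  have key : ∀ a' b', b' ≤ a' → a' + b' < a + b → ∀ e,
      lowWeightCount e (a' + b') ≤ lowWeightCount e a' + lowWeightCount (e - 1) b' := by
    intro a' b' h h' e
    cases e with
    | zero => simp
    | succ e => exact ih _ h' a' b' h e rfl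
  rcases Nat.eq_zero_or_pos b with rfl | hb
  · simp
  rcases hba.eq_or_lt with rfl | hlt
  -- With `a = b` removed, an odd `b` still leaves room for `b' + 1 ≤ a'` below.
  · rw [← two_mul, lowWeightCount_two_mul]
  obtain ⟨a', rfl | rfl⟩ := Nat.even_or_odd' a <;> obtain ⟨b', rfl | rfl⟩ := Nat.even_or_odd' b
  · have h1 := key a' b' (by omega) (by omega) (e + 1)
    have h2 := key a' b' (by omega) (by omega) e
    cases e with
    | zero =>
      rw [← mul_add, lowWeightCount_two_mul, lowWeightCount_two_mul]
      simp at *; omega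
    | succ e =>
      rw [← mul_add, lowWeightCount_two_mul, lowWeightCount_two_mul, lowWeightCount_two_mul]
      simp at *; omega
  · have h1 := key a' (b' + 1) (by omega) (by omega) (e + 1)
    have h2 := key a' b' (by omega) (by omega) e
    rw [show 2 * a' + (2 * b' + 1) = 2 * (a' + b') + 1 by ring]
    cases e with
    | zero =>
      rw [lowWeightCount_two_mul, lowWeightCount_two_mul_add_one]
      simp [add_assoc] at *; omega
    | succ e =>
      rw [lowWeightCount_two_mul, lowWeightCount_two_mul_add_one, lowWeightCount_two_mul_add_one]
      simp [add_assoc] at *; omega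
  · have h1 := key (a' + 1) b' (by omega) (by omega) (e + 1)
    have h2 := key a' b' (by omega) (by omega) e
    rw [show 2 * a' + 1 + 2 * b' = 2 * (a' + b') + 1 by ring]
    rw [show a' + 1 + b' = a' + b' + 1 by ring] at h1
    cases e with
    | zero =>
      rw [lowWeightCount_two_mul_add_one, lowWeightCount_two_mul_add_one]
      simp at *; omega
    | succ e =>
      rw [lowWeightCount_two_mul, lowWeightCount_two_mul_add_one, lowWeightCount_two_mul_add_one]
      simp at *; omega
  · have h1 := key (a' + 1) b' (by omega) (by omega) (e + 1)
    have h2 := key a' (b' + 1) (by omega) (by omega) e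
    rw [show 2 * a' + 1 + (2 * b' + 1) = 2 * (a' + b' + 1) by ring]
    rw [show a' + 1 + b' = a' + b' + 1 by ring] at h1
    rw [← add_assoc] at h2
    cases e with
    | zero =>
      rw [lowWeightCount_two_mul, lowWeightCount_two_mul_add_one]
      simp at *; omega
    | succ e =>
      have h3 := lowWeightCount_exchange e b'
      rw [lowWeightCount_two_mul, lowWeightCount_two_mul_add_one, lowWeightCount_two_mul_add_one]
      simp at *; omega

theorem choose_le_lowWeightCount (m d : ℕ) : m.choose d ≤ lowWeightCount (d + 1) (2 ^ m) := by
  induction m generalizing d with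
  | zero => rw [pow_zero, lowWeightCount_one]; cases d <;> simp
  | succ m ih =>
    rw [pow_succ', lowWeightCount_two_mul]
    cases d with
    | zero => simpa using ih 0
    | succ d => rw [Nat.choose_succ_succ]; linarith [ih d, ih (d + 1)]

theorem lowWeightCount_mono (e : ℕ) : Monotone (lowWeightCount e) := fun _ _ h =>
  sum_le_sum_of_subset (range_subset_range.2 h)

/-! ### Interpolation by functions of low degree -/

/-- The functions on the cube given by multilinear polynomials of degree less than `e`. -/
def lowDegree (n e : ℕ) : Submodule (ZMod 2) (Cube n → ZMod 2) :=
  Submodule.span (ZMod 2) {g | ∃ I : Finset (Fin n), #I < e ∧ g = fun x => ∏ i ∈ I, x i}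

theorem lowDegree_mono {n e e' : ℕ} (h : e ≤ e') : lowDegree n e ≤ lowDegree n e' :=
  Submodule.span_mono fun _ ⟨I, hI, hg⟩ => ⟨I, hI.trans_le h, hg⟩

theorem const_mem_lowDegree {n e : ℕ} (c : ZMod 2) : (fun _ => c) ∈ lowDegree n (e + 1) := by
  have : (fun _ => 1 : Cube n → ZMod 2) ∈ lowDegree n (e + 1) :=
    Submodule.subset_span ⟨∅, by simp, by simp⟩
  convert Submodule.smul_mem _ c this using 1
  ext; simp

theorem coord_mul_mem_lowDegree {n e : ℕ} (i : Fin n) {g : Cube n → ZMod 2}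
    (hg : g ∈ lowDegree n e) : (fun x => x i * g x) ∈ lowDegree n (e + 1) := by
  induction hg using Submodule.span_induction with
  | mem g hg =>
    obtain ⟨I, hI, rfl⟩ := hg
    refine Submodule.subset_span ⟨insert i I, (card_insert_le _ _).trans_lt (by omega), ?_⟩
    ext x
    by_cases hi : i ∈ I
    · change x i * ∏ j ∈ I, x j = _
      have hsq : x i * x i = x i := by
        generalize x i = y
        revert y; decide
      rw [insert_eq_of_mem hi, ← mul_prod_erase I _ hi, ← mul_assoc, hsq]
    · rw [prod_insert hi]
  | zero =>
    convert Submodule.zero_mem _ using 1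
    ext x; simp
  | add g g' _ _ h h' =>
    convert Submodule.add_mem _ h h' using 1
    ext x; simp [mul_add]
  | smul c g _ h =>
    convert Submodule.smul_mem _ c h using 1
    ext x; simp; ring

/-- Every function on `T` is the restriction of a function in `V`. -/
def Interpolates {n : ℕ} (V : Submodule (ZMod 2) (Cube n → ZMod 2)) (T : Finset (Cube n)) : Prop :=
  ∀ f : Cube n → ZMod 2, ∃ g ∈ V, ∀ x ∈ T, g x = f x

theorem Interpolates.mono {n : ℕ} {V : Submodule (ZMod 2) (Cube n → ZMod 2)}
    {T T' : Finset (Cube n)} (h : Interpolates V T) (hT : T' ⊆ T) : Interpolates V T' := fun f =>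
  let ⟨g, hg, h⟩ := h f
  ⟨g, hg, fun x hx => h x (hT hx)⟩

theorem interpolates_union {n e : ℕ} (i : Fin n) (a : ZMod 2) {T T' : Finset (Cube n)}
    (hT : Interpolates (lowDegree n (e + 1)) T) (hT' : Interpolates (lowDegree n e) T')
    (ha : ∀ x ∈ T, x i = a) (ha' : ∀ x ∈ T', x i = a + 1) :
    Interpolates (lowDegree n (e + 1)) (T ∪ T') := by
  intro f
  obtain ⟨g, hg, hgf⟩ := hT f
  obtain ⟨r, hr, hrf⟩ := hT' (f - g)
  -- The correction `(x i - a) * r` vanishes on `T` and equals `r` on `T'`, at the price of one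
  -- degree.
  refine ⟨g + ((fun x => x i * r x) - a • r), Submodule.add_mem _ hg (Submodule.sub_mem _
    (coord_mul_mem_lowDegree i hr)
    (Submodule.smul_mem _ _ (lowDegree_mono (Nat.le_succ e) hr))), fun x hx => ?_⟩
  rcases mem_union.1 hx with hx | hx
  · simp [ha x hx, hgf x hx]
  · simp [ha' x hx, hrf x hx]; ring

/-- Cut `S` along a coordinate that is not constant on it. The larger half keeps the degree bound,
the smaller one gives up one degree, and the two interpolating sets are glued by
`interpolates_union`. -/
theorem exists_interpolates {n : ℕ} (S : Finset (Cube n)) (e : ℕ) :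
    ∃ T ⊆ S, Interpolates (lowDegree n e) T ∧ lowWeightCount e #S ≤ #T := by
  induction hs : #S using Nat.strong_induction_on generalizing S e with
  | _ s ih =>
  subst hs
  cases e with
  | zero => exact ⟨∅, by simp, fun f => ⟨0, Submodule.zero_mem _, by simp⟩, by simp⟩
  | succ e =>
  rcases Nat.lt_or_ge 1 #S with h1 | h1
  · obtain ⟨x, hx, y, hy, hxy⟩ := one_lt_card.1 h1
    obtain ⟨i, hi⟩ := Function.ne_iff.1 hxy
    have hsplit (a : ZMod 2) : #(S.filter (· i = a)) + #(S.filter (· i = a + 1)) = #S := by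
      rw [← card_filter_add_card_filter_not (s := S) (· i = a)]
      congr 2
      ext z
      simp only [mem_filter, and_congr_right_iff]
      intro _
      generalize z i = b
      revert a b; decide
    have hpos (a : ZMod 2) : 0 < #(S.filter (· i = a)) := by
      rw [card_pos]
      have : x i = a ∨ y i = a := by
        revert hi; generalize x i = b; generalize y i = c; revert a b c; decide
      rcases this with h | h
      · exact ⟨x, by simp [hx, h]⟩
      · exact ⟨y, by simp [hy, h]⟩
    obtain ⟨a, ha⟩ : ∃ a, #(S.filter (· i = a + 1)) ≤ #(S.filter (· i = a)) := by
      rcases le_total #(S.filter (· i = 0)) #(S.filter (· i = 1)) with h | h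
      · exact ⟨1, h⟩
      · exact ⟨0, h⟩
    have hS := hsplit a
    have hp := hpos a
    have hp' := hpos (a + 1)
    obtain ⟨T, hTS, hT, hTc⟩ := ih _ (by omega) (S.filter (· i = a)) (e + 1) rfl
    obtain ⟨T', hTS', hT', hTc'⟩ := ih _ (by omega) (S.filter (· i = a + 1)) e rfl
    have hTa : ∀ x ∈ T, x i = a := fun x hx => (mem_filter.1 (hTS hx)).2
    have hTa' : ∀ x ∈ T', x i = a + 1 := fun x hx => (mem_filter.1 (hTS' hx)).2
    refine ⟨T ∪ T', union_subset (hTS.trans (filter_subset _ _))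
      (hTS'.trans (filter_subset _ _)), interpolates_union i a hT hT' hTa hTa', ?_⟩
    rw [card_union_of_disjoint, ← hS]
    · exact (lowWeightCount_add_le _ _ ha e).trans (add_le_add hTc hTc')
    · rw [disjoint_left]
      intro x hx hx'
      have := (hTa x hx).symm.trans (hTa' x hx')
      revert this; clear * -; revert a; decide
  · refine ⟨S, subset_rfl, fun f => ?_, ?_⟩
    · rcases S.eq_empty_or_nonempty with rfl | ⟨x, hx⟩
      · exact ⟨0, Submodule.zero_mem _, by simp⟩
      · refine ⟨fun _ => f x, const_mem_lowDegree _, fun y hy => ?_⟩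
        rw [card_le_one.1 h1 y hy x hx]
    · interval_cases #S <;> simp [lowWeightCount_one]

theorem exists_interpolates_card {n m : ℕ} (d : ℕ) {S : Finset (Cube n)} (hS : 2 ^ m ≤ #S) :
    ∃ T ⊆ S, Interpolates (lowDegree n (d + 1)) T ∧ #T = m.choose d := by
  obtain ⟨T, hTS, hT, hc⟩ := exists_interpolates S (d + 1)
  obtain ⟨T', hT', hc'⟩ := exists_subset_card_eq
    (((choose_le_lowWeightCount m d).trans (lowWeightCount_mono _ hS)).trans hc)
  exact ⟨T', hT'.trans hTS, hT.mono hT', hc'⟩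

/-! ### Concentration on an interpolating set -/

theorem exists_Poly_of_mem_lowDegree {n d : ℕ} {g : Cube n → ZMod 2}
    (hg : g ∈ lowDegree n (d + 1)) : ∃ p ∈ Poly n d, ∀ x, MvPolynomial.eval x p = g x := by
  induction hg using Submodule.span_induction with
  | mem g hg =>
    obtain ⟨I, hI, rfl⟩ := hg
    refine ⟨∏ i ∈ I, MvPolynomial.X i, ?_, fun x => by simp⟩
    rw [mem_Poly]
    refine ⟨(MvPolynomial.totalDegree_finsetProd _ _).trans ?_, fun j => ?_⟩
    · simp; omega
    · refine (MvPolynomial.degreeOf_prod_le _ _ _).trans ?_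
      simp only [MvPolynomial.degreeOf_X]
      rw [sum_ite_eq]; split_ifs <;> simp
  | zero => exact ⟨0, Submodule.zero_mem _, by simp⟩
  | add g g' _ _ h h' =>
    obtain ⟨p, hp, h⟩ := h
    obtain ⟨p', hp', h'⟩ := h'
    exact ⟨p + p', Submodule.add_mem _ hp hp', by simp [h, h']⟩
  | smul c g _ h =>
    obtain ⟨p, hp, h⟩ := h
    exact ⟨c • p, Submodule.smul_mem _ _ hp, by simp [h]⟩

/-- The nontrivial additive character of `ZMod 2`. -/
def sign (b : ZMod 2) : ℝ := if b = 0 then 1 else -1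

theorem abs_sign (b : ZMod 2) : |sign b| = 1 := by
  unfold sign; split_ifs <;> simp

/-- All fibres of a surjective homomorphism have equal size, so it carries the uniform distribution
to the uniform distribution. -/
theorem sum_comp_surjective {G H : Type*} [AddGroup G] [AddGroup H] [Fintype G] [Fintype H]
    [DecidableEq H] (ρ : G →+ H) (hρ : Function.Surjective ρ) (Φ : H → ℝ) :
    (Fintype.card H : ℝ) * ∑ g, Φ (ρ g) = Fintype.card G * ∑ h, Φ h := by
  have hfib (h : H) : #{g | ρ g = h} = #{g | ρ g = 0} :=
    AddMonoidHom.card_fiber_eq_of_mem_range ρ (hρ h) (hρ 0)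
  have hsum (Ψ : H → ℝ) : ∑ g, Ψ (ρ g) = #{g | ρ g = 0} * ∑ h, Ψ h := by
    rw [← sum_fiberwise univ ρ, mul_sum]
    refine sum_congr rfl fun h _ => ?_
    rw [sum_congr rfl (g := fun _ => Ψ h) fun g hg => by rw [(mem_filter.1 hg).2],
      sum_const, hfib, nsmul_eq_mul]
  have h1 := hsum fun _ => 1
  simp only [sum_const, card_univ, nsmul_eq_mul, mul_one] at h1
  rw [hsum, h1]; ring

theorem sum_exp_sign_le {ι : Type*} [Fintype ι] [DecidableEq ι] (v : ι → ℝ) :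
    ∑ f : ι → ZMod 2, Real.exp (∑ i, v i * sign (f i)) ≤
      (Fintype.card (ι → ZMod 2) : ℝ) * Real.exp (∑ i, v i ^ 2 / 2) := by
  have h : ∑ f : ι → ZMod 2, Real.exp (∑ i, v i * sign (f i)) =
      ∏ i, ∑ b : ZMod 2, Real.exp (v i * sign b) := by
    rw [prod_univ_sum, Fintype.piFinset_univ]
    exact sum_congr rfl fun f _ => Real.exp_sum _ _
  have hb (i : ι) : ∑ b : ZMod 2, Real.exp (v i * sign b) = 2 * Real.cosh (v i) := by
    rw [Real.cosh_eq, show (univ : Finset (ZMod 2)) = {0, 1} from rfl,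
      sum_pair (by decide)]
    simp [sign]; ring
  rw [h, Real.exp_sum, Fintype.card_fun, ZMod.card]
  simp_rw [hb]
  rw [prod_mul_distrib, prod_const, card_univ]
  push_cast
  gcongr with i
  exact Real.cosh_le_exp_half_sq _

/-- Restriction of polynomials to functions on a set of points. -/
def restrictPoly {n : ℕ} (d : ℕ) (T : Finset (Cube n)) : Poly n d →+ (T → ZMod 2) where
  toFun p x := MvPolynomial.eval (x : Cube n) (p : MvPolynomial (Fin n) (ZMod 2))
  map_zero' := by ext; simp
  map_add' p q := by ext; simp

theorem restrictPoly_surjective {n d : ℕ} {T : Finset (Cube n)}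
    (hT : Interpolates (lowDegree n (d + 1)) T) : Function.Surjective (restrictPoly d T) := by
  intro f
  obtain ⟨g, hg, hgf⟩ := hT fun x => if h : x ∈ T then f ⟨x, h⟩ else 0
  obtain ⟨p, hp, hpg⟩ := exists_Poly_of_mem_lowDegree hg
  refine ⟨⟨p, hp⟩, funext fun x => ?_⟩
  change MvPolynomial.eval (x : Cube n) p = f x
  rw [hpg, hgf x x.2]; simp

theorem sum_exp_eval_le {n d : ℕ} [Fintype (Poly n d)] {T : Finset (Cube n)}
    (hT : Interpolates (lowDegree n (d + 1)) T) (v : Cube n → ℝ) :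
    ∑ p : Poly n d, Real.exp (∑ x ∈ T, v x * sign (MvPolynomial.eval x p.1)) ≤
      (Fintype.card (Poly n d) : ℝ) * Real.exp (∑ x ∈ T, v x ^ 2 / 2) := by
  have h1 := sum_comp_surjective (restrictPoly d T) (restrictPoly_surjective hT)
    fun f => Real.exp (∑ x : T, v x * sign (f x))
  have h2 := sum_exp_sign_le fun x : T => v x
  have h3 : ∀ p : Poly n d, ∑ x : T, v x * sign (restrictPoly d T p x) =
      ∑ x ∈ T, v x * sign (MvPolynomial.eval x p.1) := fun p =>
    sum_coe_sort T fun x => v x * sign (MvPolynomial.eval x p.1)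
  simp_rw [h3] at h1
  rw [sum_coe_sort T fun x => v x ^ 2 / 2] at h2
  have hpos : (0 : ℝ) < Fintype.card (T → ZMod 2) := by exact_mod_cast Fintype.card_pos
  refine le_of_mul_le_mul_left ?_ hpos
  rw [h1, mul_left_comm]
  gcongr

/-- Hoeffding's argument: Markov's inequality for `exp (l * B p)` with the optimal `l = ± δ / M`,
one sign for each tail. -/
theorem card_large_bias_le {n d : ℕ} [Fintype (Poly n d)] {T : Finset (Cube n)}
    (hT : Interpolates (lowDegree n (d + 1)) T) {w : Cube n → ℝ} {M δ : ℝ} (hM : 0 < M)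
    (hδ : 0 ≤ δ) (hw : ∀ x ∈ T, |w x| ≤ M) :
    (#{p : Poly n d | δ * #T * M < |∑ x ∈ T, w x * sign (MvPolynomial.eval x p.1)|} : ℝ) ≤
      Fintype.card (Poly n d) * (2 * Real.exp (-(δ ^ 2 * #T / 2))) := by
  set B : Poly n d → ℝ := fun p => ∑ x ∈ T, w x * sign (MvPolynomial.eval x p.1) with hB
  change (#{p : Poly n d | δ * #T * M < |B p|} : ℝ) ≤ _
  have hmgf (l : ℝ) (hl : l ^ 2 = (δ / M) ^ 2) : ∑ p : Poly n d, Real.exp (l * B p) ≤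
      Fintype.card (Poly n d) * Real.exp (δ ^ 2 * #T / 2) := by
    have h := sum_exp_eval_le hT fun x => l * w x
    have h' : ∑ x ∈ T, (l * w x) ^ 2 / 2 ≤ δ ^ 2 * #T / 2 := by
      have : ∀ x ∈ T, (l * w x) ^ 2 / 2 ≤ δ ^ 2 / 2 := by
        intro x hx
        have hx2 : w x ^ 2 ≤ M ^ 2 := sq_le_sq' (abs_le.1 (hw x hx)).1 (abs_le.1 (hw x hx)).2
        rw [mul_pow, hl]
        calc (δ / M) ^ 2 * w x ^ 2 / 2 ≤ (δ / M) ^ 2 * M ^ 2 / 2 := by gcongr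
          _ = δ ^ 2 / 2 := by field_simp
      refine (sum_le_sum this).trans_eq ?_
      rw [sum_const, nsmul_eq_mul]; ring
    simp only [hB, mul_sum]
    simp only [mul_assoc] at h ⊢
    exact h.trans (by gcongr)
  have h1 := hmgf (δ / M) rfl
  have h2 := hmgf (-(δ / M)) (by ring)
  have h3 : (#{p : Poly n d | δ * #T * M < |B p|} : ℝ) * Real.exp (δ ^ 2 * #T) ≤
      ∑ p : Poly n d, (Real.exp (δ / M * B p) + Real.exp (-(δ / M) * B p)) := by
    rw [← nsmul_eq_mul, ← sum_const]
    refine (sum_le_sum (g := fun p => Real.exp (δ / M * B p) + Real.exp (-(δ / M) * B p))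
      fun p hp => ?_).trans (sum_le_sum_of_subset_of_nonneg (subset_univ _)
        fun p _ _ => by positivity)
    have hp := (mem_filter.1 hp).2
    have : δ ^ 2 * #T ≤ δ / M * |B p| := by
      calc δ ^ 2 * #T = δ / M * (δ * #T * M) := by field_simp
        _ ≤ _ := by gcongr
    rcases abs_cases (B p) with ⟨h, _⟩ | ⟨h, _⟩
    · rw [h] at this
      have := Real.exp_le_exp.2 this
      have := Real.exp_pos (-(δ / M) * B p)
      linarith
    · rw [h] at this
      have := Real.exp_le_exp.2 (this.trans_eq (by ring : _ = -(δ / M) * B p))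
      have := Real.exp_pos (δ / M * B p)
      linarith
  rw [sum_add_distrib] at h3
  refine le_of_mul_le_mul_right (h3.trans ((add_le_add h1 h2).trans_eq ?_))
    (Real.exp_pos (δ ^ 2 * #T))
  have : Real.exp (δ ^ 2 * #T / 2) = Real.exp (-(δ ^ 2 * #T / 2)) * Real.exp (δ ^ 2 * #T) := by
    rw [← Real.exp_add]; ring_nf
  rw [this]; ring

/-! ### Decomposing a source into blocks -/

theorem exists_disjoint_blocks {n m d : ℕ} (hdm : d ≤ m) {w : Cube n → ℝ} {K : ℝ} (hK : 0 < K)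
    (hw0 : ∀ x, 0 ≤ w x) (hwK : ∀ x, w x ≤ K) :
    ∃ 𝒯 : Finset (Finset (Cube n)), (𝒯 : Set (Finset (Cube n))).PairwiseDisjoint id ∧
      (∀ T ∈ 𝒯, Interpolates (lowDegree n (d + 1)) T ∧ #T = m.choose d ∧
        ∃ M > 0, ∀ x ∈ T, M / 2 ≤ w x ∧ w x ≤ M) ∧
      ∑ x ∈ (𝒯.biUnion id)ᶜ, w x ≤ 2 * 2 ^ m * K := by
  set IsBlock : Finset (Cube n) → Prop := fun T =>
    Interpolates (lowDegree n (d + 1)) T ∧ #T = m.choose d ∧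
        ∃ M > 0, ∀ x ∈ T, M / 2 ≤ w x ∧ w x ≤ M with hB
  obtain ⟨𝒯, ⟨hdisj, hblock⟩, hmax⟩ := (Set.toFinite {𝒯 : Finset (Finset (Cube n)) |
    (𝒯 : Set (Finset (Cube n))).PairwiseDisjoint id ∧ ∀ T ∈ 𝒯, IsBlock T}).exists_maximal
    ⟨∅, by simp⟩
  refine ⟨𝒯, hdisj, hblock, ?_⟩
  -- Dyadic levels; points of weight zero get a dummy level and are excluded from `R`.
  have hlevel (x : Cube n) : ∃ j : ℕ, w x ≤ K * (1 / 2) ^ j ∧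
      (0 < w x → K * (1 / 2) ^ j / 2 ≤ w x) := by
    rcases (hw0 x).eq_or_lt with h | h
    · exact ⟨0, by simpa using hwK x, fun h' => absurd h h'.ne⟩
    · obtain ⟨j, hj, hj'⟩ := exists_nat_pow_near_of_lt_one (div_pos h hK)
        ((div_le_one hK).2 (hwK x)) (by norm_num : (0 : ℝ) < 1 / 2) (by norm_num)
      rw [div_le_iff₀ hK] at hj'
      rw [lt_div_iff₀ hK, pow_succ] at hj
      exact ⟨j, by linarith, fun _ => by linarith⟩
  choose ℓ hℓ hℓ' using hlevel
  set R := (𝒯.biUnion id)ᶜ.filter (0 < w ·) with hR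
  have hsmall (j : ℕ) : #{x ∈ R | ℓ x = j} < 2 ^ m := by
    by_contra! hge
    obtain ⟨T, hTR, hT, hTc⟩ := exists_interpolates_card d hge
    have hTb : IsBlock T := by
      refine ⟨hT, hTc, K * (1 / 2) ^ j, by positivity, fun x hx => ?_⟩
      have hx := mem_filter.1 (hTR hx)
      rw [← hx.2]
      exact ⟨hℓ' x (mem_filter.1 hx.1).2, hℓ x⟩
    have hTd : ∀ T' ∈ 𝒯, Disjoint T T' := by
      intro T' hT'
      rw [disjoint_left]
      intro x hx hx'
      have := (mem_filter.1 (mem_filter.1 (hTR hx)).1).1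
      exact mem_compl.1 this (mem_biUnion.2 ⟨T', hT', hx'⟩)
    have hTmem : T ∈ 𝒯 := by
      refine hmax (y := insert T 𝒯) ⟨?_, ?_⟩ (subset_insert _ _) (mem_insert_self _ _)
      · rw [coe_insert]
        exact hdisj.insert fun T' hT' _ => hTd T' hT'
      · simpa using ⟨hTb, hblock⟩
    -- The new block would be disjoint from itself, hence empty, but `d ≤ m` makes its size
    -- positive.
    have := hTd T hTmem
    rw [disjoint_self_iff_empty] at this
    rw [this, card_empty] at hTc
    exact (Nat.choose_pos hdm).ne hTc
  have hRsum : ∑ x ∈ (𝒯.biUnion id)ᶜ, w x = ∑ x ∈ R, w x := by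
    rw [hR, sum_filter]
    refine sum_congr rfl fun x _ => ?_
    split_ifs with h
    · rfl
    · exact le_antisymm (not_lt.1 h) (hw0 x)
  rw [hRsum, ← sum_fiberwise_of_maps_to (t := R.image ℓ) fun x hx => mem_image_of_mem _ hx]
  have hfib (j : ℕ) : ∑ x ∈ R with ℓ x = j, w x ≤ 2 ^ m * K * (1 / 2) ^ j := by
    calc ∑ x ∈ R with ℓ x = j, w x ≤ ∑ x ∈ R with ℓ x = j, K * (1 / 2) ^ j :=
          sum_le_sum fun x hx => by rw [← (mem_filter.1 hx).2]; exact hℓ x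
      _ = #{x ∈ R | ℓ x = j} * (K * (1 / 2) ^ j) := by rw [sum_const, nsmul_eq_mul]
      _ ≤ 2 ^ m * (K * (1 / 2) ^ j) := by
          gcongr
          exact_mod_cast (hsmall j).le
      _ = _ := by ring
  refine (sum_le_sum fun j _ => hfib j).trans ?_
  rw [← mul_sum]
  have := summable_geometric_two.sum_le_tsum (R.image ℓ) fun j _ => by positivity
  rw [tsum_geometric_two] at this
  calc _ ≤ 2 ^ m * K * 2 := by gcongr
    _ = _ := by ring

theorem card_le_of_pairwiseDisjoint {α : Type*} [Fintype α] [DecidableEq α]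
    {𝒯 : Finset (Finset α)} (h : (𝒯 : Set (Finset α)).PairwiseDisjoint id)
    (hne : ∀ T ∈ 𝒯, 0 < #T) : #𝒯 ≤ Fintype.card α := by
  calc #𝒯 = ∑ T ∈ 𝒯, 1 := by simp
    _ ≤ ∑ T ∈ 𝒯, #(id T) := sum_le_sum hne
    _ = #(𝒯.biUnion id) := (card_biUnion h).symm
    _ ≤ _ := card_le_univ _

theorem card_biased_le {n m d : ℕ} [Fintype (Poly n d)] (hdm : d ≤ m) {w : Cube n → ℝ} {K δ : ℝ}
    (hK : 0 < K) (hδ : 0 ≤ δ) (hw0 : ∀ x, 0 ≤ w x) (hwK : ∀ x, w x ≤ K) (hw1 : ∑ x, w x ≤ 1) :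
    (#{p : Poly n d | 2 * δ + 2 * 2 ^ m * K <
        |∑ x, w x * sign (MvPolynomial.eval x p.1)|} : ℝ) ≤
      Fintype.card (Poly n d) * (2 ^ n * (2 * Real.exp (-(δ ^ 2 * m.choose d / 2)))) := by
  classical
  obtain ⟨𝒯, hdisj, hblock, hrem⟩ := exists_disjoint_blocks hdm hK hw0 hwK
  have hM : ∀ T, ∃ M : ℝ, T ∈ 𝒯 → 0 < M ∧ ∀ x ∈ T, M / 2 ≤ w x ∧ w x ≤ M := by
    intro T
    by_cases hT : T ∈ 𝒯
    · obtain ⟨M, h⟩ := (hblock T hT).2.2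
      exact ⟨M, fun _ => h⟩
    · exact ⟨0, fun h => absurd h hT⟩
  choose M hM using hM
  set B : Finset (Cube n) → Poly n d → ℝ := fun T p =>
    ∑ x ∈ T, w x * sign (MvPolynomial.eval x p.1) with hB
  have hsub : ({p : Poly n d | 2 * δ + 2 * 2 ^ m * K <
      |∑ x, w x * sign (MvPolynomial.eval x p.1)|} : Finset (Poly n d)) ⊆
      𝒯.biUnion fun T => {p : Poly n d | δ * #T * M T < |B T p|} := by
    intro p hp
    have hp := (mem_filter.1 hp).2
    by_contra hcon
    have hgood : ∀ T ∈ 𝒯, |B T p| ≤ δ * #T * M T := by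
      intro T hT
      by_contra! h
      exact hcon (mem_biUnion.2 ⟨T, hT, by simpa using h⟩)
    refine hp.not_ge ?_
    have hdec : ∑ x, w x * sign (MvPolynomial.eval x p.1) =
        ∑ T ∈ 𝒯, B T p + B (𝒯.biUnion id)ᶜ p := by
      rw [← sum_add_sum_compl (𝒯.biUnion id), sum_biUnion hdisj]
      rfl
    have habs (T : Finset (Cube n)) : |B T p| ≤ ∑ x ∈ T, w x := by
      refine (abs_sum_le_sum_abs _ _).trans_eq (sum_congr rfl fun x _ => ?_)
      rw [abs_mul, abs_sign, mul_one, abs_of_nonneg (hw0 x)]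
    have hpart : ∑ T ∈ 𝒯, |B T p| ≤ 2 * δ := by
      calc ∑ T ∈ 𝒯, |B T p| ≤ ∑ T ∈ 𝒯, 2 * δ * ∑ x ∈ T, w x := by
            refine sum_le_sum fun T hT => (hgood T hT).trans ?_
            -- Weights within a factor 2 turn the block bound into `2 * δ` times the mass of the
            -- block, and masses add up to at most 1.
            have : #T * (M T / 2) ≤ ∑ x ∈ T, w x := by
              rw [← nsmul_eq_mul]
              exact card_nsmul_le_sum _ _ _ fun x hx => ((hM T hT).2 x hx).1
            calc δ * #T * M T = 2 * δ * (#T * (M T / 2)) := by ring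
              _ ≤ _ := by gcongr
        _ = 2 * δ * ∑ x ∈ 𝒯.biUnion id, w x := by rw [← mul_sum, sum_biUnion hdisj]; rfl
        _ ≤ 2 * δ * ∑ x, w x := by
            exact mul_le_mul_of_nonneg_left (sum_le_sum_of_subset_of_nonneg (subset_univ _)
              fun x _ _ => hw0 x) (by positivity)
        _ ≤ 2 * δ * 1 := by gcongr
        _ = 2 * δ := mul_one _
    rw [hdec]
    exact (abs_add_le _ _).trans (add_le_add ((abs_sum_le_sum_abs _ _).trans hpart)
      ((habs _).trans hrem))
  have hcard : (#𝒯 : ℝ) ≤ 2 ^ n := by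
    have := card_le_of_pairwiseDisjoint hdisj fun T hT => by
      rw [(hblock T hT).2.1]; exact Nat.choose_pos hdm
    rw [Fintype.card_fun, ZMod.card, Fintype.card_fin] at this
    exact_mod_cast this
  calc _ ≤ ((∑ T ∈ 𝒯, #{p : Poly n d | δ * #T * M T < |B T p|} : ℕ) : ℝ) := by
        exact_mod_cast (card_le_card hsub).trans card_biUnion_le
    _ ≤ ∑ T ∈ 𝒯, Fintype.card (Poly n d) * (2 * Real.exp (-(δ ^ 2 * m.choose d / 2))) := by
        push_cast
        refine sum_le_sum fun T hT => ?_
        rw [← (hblock T hT).2.1]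
        refine card_large_bias_le (hblock T hT).1 (hM T hT).1 hδ fun x hx => ?_
        rw [abs_of_nonneg (hw0 x)]
        exact ((hM T hT).2 x hx).2
    _ = #𝒯 * (Fintype.card (Poly n d) * (2 * Real.exp (-(δ ^ 2 * m.choose d / 2)))) := by
        rw [sum_const, nsmul_eq_mul]
    _ ≤ 2 ^ n * (Fintype.card (Poly n d) * (2 * Real.exp (-(δ ^ 2 * m.choose d / 2)))) := by
        gcongr
    _ = _ := by ring

/-! ### Bias, statistical distance and mixtures -/

/-- The expectation of `(-1) ^ f(Y)`. -/
def bias {n : ℕ} (f : Cube n → ZMod 2) (Y : PMF (Cube n)) : ℝ := ∑ x, (Y x).toReal * sign (f x)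

theorem sum_toReal {α : Type*} [Fintype α] (Y : PMF α) : ∑ x, (Y x).toReal = 1 := by
  have h := Y.tsum_coe
  rw [tsum_fintype] at h
  rw [← ENNReal.toReal_sum fun x _ => Y.apply_ne_top x, h, ENNReal.toReal_one]

theorem statDist_map_uniform {n : ℕ} (f : Cube n → ZMod 2) (Y : PMF (Cube n)) :
    statDist (Y.map f) (PMF.uniformOfFintype (ZMod 2)) = |bias f Y| / 2 := by
  have hmap (b : ZMod 2) : ((Y.map f) b).toReal = ∑ x, if b = f x then (Y x).toReal else 0 := by
    rw [PMF.map_apply, tsum_fintype, ENNReal.toReal_sum]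
    · refine sum_congr rfl fun x _ => ?_
      split_ifs <;> simp
    · intro x _
      split_ifs
      · exact Y.apply_ne_top x
      · simp
  have hz (y : ZMod 2) : (0 = y ∧ ¬ 1 = y ∧ y = 0) ∨ (¬ 0 = y ∧ 1 = y ∧ y ≠ 0) := by
    revert y; decide
  have hadd : ((Y.map f) 0).toReal + ((Y.map f) 1).toReal = 1 := by
    rw [hmap, hmap, ← sum_add_distrib, ← sum_toReal Y]
    refine sum_congr rfl fun x _ => ?_
    rcases hz (f x) with ⟨h0, h1, _⟩ | ⟨h0, h1, _⟩
    · rw [if_pos h0, if_neg h1, add_zero]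
    · rw [if_neg h0, if_pos h1, zero_add]
  have hsub : ((Y.map f) 0).toReal - ((Y.map f) 1).toReal = bias f Y := by
    rw [hmap, hmap, ← sum_sub_distrib]
    refine sum_congr rfl fun x _ => ?_
    unfold sign
    rcases hz (f x) with ⟨h0, h1, h2⟩ | ⟨h0, h1, h2⟩
    · rw [if_pos h0, if_neg h1, if_pos h2]; ring
    · rw [if_neg h0, if_pos h1, if_neg h2]; ring
  unfold statDist
  rw [show (univ : Finset (ZMod 2)) = {0, 1} from rfl, sum_pair (by decide)]
  simp only [PMF.uniformOfFintype_apply, ZMod.card, ENNReal.toReal_inv, Nat.cast_ofNat,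
    ENNReal.toReal_ofNat]
  rw [show ((Y.map f) 0).toReal - 2⁻¹ = bias f Y / 2 by linarith,
    show ((Y.map f) 1).toReal - 2⁻¹ = -(bias f Y / 2) by linarith, abs_neg, abs_div,
    abs_of_pos (two_pos : (0 : ℝ) < 2)]
  ring

theorem abs_bias_le_one {n : ℕ} (f : Cube n → ZMod 2) (Y : PMF (Cube n)) : |bias f Y| ≤ 1 := by
  rw [← sum_toReal Y]
  refine (abs_sum_le_sum_abs _ _).trans_eq (sum_congr rfl fun x _ => ?_)
  rw [abs_mul, abs_sign, mul_one, abs_of_nonneg ENNReal.toReal_nonneg]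

theorem abs_bias_sub_le {n : ℕ} (f : Cube n → ZMod 2) (Y Z : PMF (Cube n)) :
    |bias f Y - bias f Z| ≤ 2 * statDist Y Z := by
  unfold bias statDist
  rw [← sum_sub_distrib, ← mul_assoc, show (2 : ℝ) * (1 / 2) = 1 by norm_num, one_mul]
  refine (abs_sum_le_sum_abs _ _).trans_eq (sum_congr rfl fun x _ => ?_)
  rw [← sub_mul, abs_mul, abs_sign, mul_one]

theorem abs_bias_le_of_isConvexCombination {n : ℕ} {f : Cube n → ZMod 2}
    {𝒳 : Finset (PMF (Cube n))} {Z : PMF (Cube n)}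
    (hZ : IsConvexCombination (𝒳 : Set (PMF (Cube n))) Z) {c : ℝ}
    (h : ∀ X ∈ 𝒳, |bias f X| ≤ c) : |bias f Z| ≤ c := by
  obtain ⟨w, hw, rfl⟩ := hZ
  have hw0 : ∀ X ∉ 𝒳, w X = 0 := fun X hX => by
    by_contra h0
    exact hX (hw ((PMF.mem_support_iff _ _).2 h0))
  have hw1 : ∑ X ∈ 𝒳, (w X).toReal = 1 := by
    have h := w.tsum_coe
    rw [tsum_eq_sum hw0] at h
    rw [← ENNReal.toReal_sum fun X _ => w.apply_ne_top X, h, ENNReal.toReal_one]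
  have hZx (x : Cube n) : ((w.bind id) x).toReal = ∑ X ∈ 𝒳, (w X).toReal * (X x).toReal := by
    rw [PMF.bind_apply, tsum_eq_sum (s := 𝒳) fun X hX => by rw [hw0 X hX, zero_mul],
      ENNReal.toReal_sum fun X _ => ENNReal.mul_ne_top (w.apply_ne_top _) (PMF.apply_ne_top _ _)]
    exact sum_congr rfl fun X _ => ENNReal.toReal_mul
  have hb : bias f (w.bind id) = ∑ X ∈ 𝒳, (w X).toReal * bias f X := by
    unfold bias
    simp_rw [hZx, sum_mul, mul_sum]
    rw [sum_comm]
    exact sum_congr rfl fun X _ => sum_congr rfl fun x _ => mul_assoc _ _ _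
  rw [hb]
  calc _ ≤ ∑ X ∈ 𝒳, (w X).toReal * c := by
        refine (abs_sum_le_sum_abs _ _).trans (sum_le_sum fun X hX => ?_)
        rw [abs_mul, abs_of_nonneg ENNReal.toReal_nonneg]
        gcongr
        exact h X hX
    _ = c := by rw [← sum_mul, hw1, one_mul]

theorem isExtractor_of_abs_bias_le {n : ℕ} {f : Cube n → ZMod 2} {𝒳 : Finset (PMF (Cube n))}
    {𝒴 : Set (PMF (Cube n))} {ε ε' : ℝ}
    (h𝒴 : ∀ Y ∈ 𝒴, ∃ Z, IsConvexCombination (𝒳 : Set (PMF (Cube n))) Z ∧ statDist Y Z ≤ ε')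
    (h : ∀ X ∈ 𝒳, |bias f X| ≤ 2 * ε) : IsExtractor f (ε + ε') 𝒴 := by
  intro Y hY
  obtain ⟨Z, hZ, hYZ⟩ := h𝒴 Y hY
  have h1 := abs_bias_le_of_isConvexCombination hZ h
  have h2 := abs_bias_sub_le f Y Z
  have h3 := abs_sub_abs_le_abs_sub (bias f Y) (bias f Z)
  rw [statDist_map_uniform]
  linarith

/-! ### Parameters and the final union bound -/

theorem toReal_le_of_le_minEntropy {α : Type*} [Fintype α] {X : PMF α} {k : ℝ}
    (hk : k ≤ minEntropy X) (x : α) : (X x).toReal ≤ 2 ^ (-k) := by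
  by_cases hx : X x = 0
  · rw [hx]; simp; positivity
  · have h : minEntropy X ≤ -Real.logb 2 (X x).toReal :=
      ciInf_le (f := fun x : X.support => -Real.logb 2 (X (x : α)).toReal)
        (Set.finite_range _).bddBelow ⟨x, (PMF.mem_support_iff _ _).2 hx⟩
    rw [← Real.logb_le_iff_le_rpow one_lt_two
      (ENNReal.toReal_pos hx (X.apply_ne_top x))]
    linarith

/-- With `u = k ^ (1/4)` and `δ = ε / 2`: the uncovered mass is at most `2 ^ (-u)`, below `ε`
because `t ≤ exp t` at `t = u / (2d)`; and `(k / (4d)) ^ d ≤ m.choose d` makes the Hoeffding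
exponent at least `d ^ d * u ^ (2d) / 8`, where `d ≥ 6` gives `d ^ d ≥ 240 = 8 * 30`. -/
theorem parameter_bounds {k : ℝ} {d : ℕ} (hk : 0 ≤ k) (hd : 6 ≤ d)
    (h : 2 * (d : ℝ) < k ^ ((1 : ℝ) / 4)) :
    d ≤ ⌊k / 2⌋₊ ∧
    2 * 2 ^ ⌊k / 2⌋₊ * (2 : ℝ) ^ (-k) ≤ (2 * (d : ℝ) / k ^ ((1 : ℝ) / 4)) ^ d ∧
    30 * k ^ ((d : ℝ) / 2) ≤
      ((2 * (d : ℝ) / k ^ ((1 : ℝ) / 4)) ^ d / 2) ^ 2 * (⌊k / 2⌋₊.choose d : ℝ) / 2 := by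
  have hd6 : (6 : ℝ) ≤ d := by exact_mod_cast hd
  have hku : k = (k ^ ((1 : ℝ) / 4)) ^ 4 := by
    rw [← Real.rpow_natCast, ← Real.rpow_mul hk]; norm_num
  have hkd : k ^ ((d : ℝ) / 2) = ((k ^ ((1 : ℝ) / 4)) ^ 2) ^ d := by
    rw [← pow_mul, ← Real.rpow_natCast, ← Real.rpow_mul hk]
    congr 1
    push_cast; ring
  rw [hkd]
  generalize k ^ ((1 : ℝ) / 4) = u at *
  have hu : 12 < u := by linarith
  have hu4 : 1000 * u ≤ u ^ 4 := by
    nlinarith [pow_le_pow_left₀ (by norm_num : (0 : ℝ) ≤ 12) hu.le 3]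
  rw [← hku] at hu4
  have hfl : (⌊k / 2⌋₊ : ℝ) ≤ k / 2 := Nat.floor_le (by linarith)
  have hfl' : k / 2 < ⌊k / 2⌋₊ + 1 := Nat.lt_floor_add_one _
  have hdm : d ≤ ⌊k / 2⌋₊ := Nat.le_floor (by linarith)
  refine ⟨hdm, ?_, ?_⟩
  · have h1 : Real.exp (-(u / 2)) ≤ (2 * (d : ℝ) / u) ^ d := by
      have : u / (2 * d) ≤ Real.exp (u / (2 * d)) := by
        linarith [Real.add_one_le_exp (u / (2 * d))]
      have h2 : (u / (2 * d)) ^ d ≤ Real.exp (u / 2) := by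
        refine (pow_le_pow_left₀ (by positivity) this d).trans_eq ?_
        rw [← Real.exp_nat_mul]
        congr 1
        field_simp
      rw [Real.exp_neg, ← inv_div u, inv_pow]
      exact inv_anti₀ (by positivity) h2
    refine le_trans ?_ h1
    have hlog : 1 / 2 < Real.log 2 := by linarith [Real.log_two_gt_d9]
    calc 2 * 2 ^ ⌊k / 2⌋₊ * (2 : ℝ) ^ (-k) = 2 ^ (1 + (⌊k / 2⌋₊ : ℝ) + -k) := by
          rw [Real.rpow_add two_pos, Real.rpow_add two_pos, Real.rpow_one, Real.rpow_natCast]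
      _ ≤ 2 ^ (-u) := Real.rpow_le_rpow_of_exponent_le one_le_two (by linarith)
      _ = Real.exp (Real.log 2 * -u) := Real.rpow_def_of_pos two_pos _
      _ ≤ Real.exp (-(u / 2)) := by
          rw [Real.exp_le_exp]
          nlinarith
  · have hch : (k / (4 * d)) ^ d ≤ (⌊k / 2⌋₊.choose d : ℝ) := by
      refine le_trans ?_ (Nat.pow_le_choose d ⌊k / 2⌋₊)
      have h1 : k / 4 ≤ ((⌊k / 2⌋₊ + 1 - d : ℕ) : ℝ) := by
        rw [Nat.cast_sub (by omega)]
        push_cast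
        linarith
      have h2 : (d.factorial : ℝ) ≤ (d : ℝ) ^ d := by exact_mod_cast Nat.factorial_le_pow d
      rw [← div_div, div_pow]
      gcongr
    have hdd : (240 : ℝ) ≤ (d : ℝ) ^ d := by
      calc (240 : ℝ) ≤ 6 ^ 6 := by norm_num
        _ ≤ (d : ℝ) ^ 6 := by gcongr
        _ ≤ (d : ℝ) ^ d := pow_le_pow_right₀ (by linarith) hd
    calc 30 * (u ^ 2) ^ d = 240 * (u ^ 2) ^ d / 8 := by ring
      _ ≤ (d : ℝ) ^ d * (u ^ 2) ^ d / 8 := by gcongr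
      _ = ((2 * (d : ℝ) / u) ^ d / 2) ^ 2 * (k / (4 * d)) ^ d / 2 := by
          have h1 : (2 * (d : ℝ) / u) ^ 2 * (k / (4 * d)) = d * u ^ 2 := by
            rw [hku]; field_simp; norm_num
          calc (d : ℝ) ^ d * (u ^ 2) ^ d / 8 = (d * u ^ 2) ^ d / 8 := by rw [mul_pow]
            _ = (((2 * (d : ℝ) / u) ^ 2) ^ d * (k / (4 * d)) ^ d) / 8 := by rw [← h1, mul_pow]
            _ = (((2 * (d : ℝ) / u) ^ d) ^ 2 * (k / (4 * d)) ^ d) / 8 := by rw [pow_right_comm]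
            _ = _ := by ring
      _ ≤ _ := by gcongr

theorem le_probPoly_isExtractor {n : ℕ} (hn : 2 ≤ n) {k : ℝ} (hk : 5 * Real.logb 2 (n : ℝ) ≤ k)
    {𝒳 : Finset (PMF (Cube n))} (h𝒳 : ∀ X ∈ 𝒳, k ≤ minEntropy X) {ε' : ℝ} {𝒴 : Set (PMF (Cube n))}
    (h𝒴 : ∀ Y ∈ 𝒴, ∃ Z, IsConvexCombination (𝒳 : Set (PMF (Cube n))) Z ∧ statDist Y Z ≤ ε')
    {d : ℕ} (hd : 6 ≤ d) :
    1 - (#𝒳 : ℝ) * Real.exp (3 * (n : ℝ) - 30 * k ^ ((d : ℝ) / 2) / (n : ℝ) ^ 2) ≤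
      probPoly n d (fun p => IsExtractor (fun x => MvPolynomial.eval x p)
        ((2 * (d : ℝ) / k ^ ((1 : ℝ) / 4)) ^ d + ε') 𝒴) := by
  classical
  have hn1 : (1 : ℝ) ≤ n := by exact_mod_cast (by omega : 1 ≤ n)
  have hk0 : 0 < k := by
    have : 0 < Real.logb 2 (n : ℝ) :=
      Real.logb_pos one_lt_two (by exact_mod_cast (by omega : 1 < n))
    linarith
  have hu0 : 0 < k ^ ((1 : ℝ) / 4) := Real.rpow_pos_of_pos hk0 _
  let _ : Fintype (Poly n d) := Fintype.ofFinite _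
  set ε := (2 * (d : ℝ) / k ^ ((1 : ℝ) / 4)) ^ d with hε
  have hε0 : 0 ≤ ε := by positivity
  have hP : (0 : ℝ) < Fintype.card (Poly n d) := by exact_mod_cast Fintype.card_pos
  set β := Real.exp (3 * (n : ℝ) - 30 * k ^ ((d : ℝ) / 2) / (n : ℝ) ^ 2) with hβ
  let bad : PMF (Cube n) → Finset (Poly n d) := fun X =>
    {p | 2 * ε < |bias (fun x => MvPolynomial.eval x p.1) X|}
  have hbad : ∀ X ∈ 𝒳, (#(bad X) : ℝ) ≤ Fintype.card (Poly n d) * β := by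
    intro X hX
    -- In the second case `ε ≥ 1`, and no bias exceeds 1.
    rcases lt_or_ge (2 * (d : ℝ)) (k ^ ((1 : ℝ) / 4)) with hlt | hge
    · obtain ⟨hdm, hrem, hexp⟩ := parameter_bounds hk0.le hd hlt
      have hcard := card_biased_le hdm (w := fun x => (X x).toReal)
        (Real.rpow_pos_of_pos two_pos (-k)) (half_pos (pow_pos (by positivity) d : 0 < ε)).le
        (fun x => ENNReal.toReal_nonneg) (toReal_le_of_le_minEntropy (h𝒳 X hX))
        (sum_toReal X).le
      calc (#(bad X) : ℝ) ≤ _ := by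
            refine Nat.cast_le.2 (card_le_card ?_)
            refine monotone_filter_right _ fun p _ hp => lt_of_le_of_lt ?_ hp
            linarith
        _ ≤ _ := hcard
        _ ≤ _ := by
            gcongr
            have hnexp : (2 : ℝ) ^ n * 2 ≤ Real.exp (3 * n) := by
              have h2 : (2 : ℝ) ≤ Real.exp 1 := by linarith [Real.add_one_le_exp (1 : ℝ)]
              calc (2 : ℝ) ^ n * 2 = 2 ^ (n + 1) := (pow_succ _ _).symm
                _ ≤ Real.exp 1 ^ (n + 1) := pow_le_pow_left₀ two_pos.le h2 _
                _ = Real.exp (n + 1) := by rw [← Real.exp_nat_mul]; simp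
                _ ≤ _ := Real.exp_le_exp.2 (by linarith)
            -- The division by `n ^ 2` is pure slack in this argument.
            have hdiv : 30 * k ^ ((d : ℝ) / 2) / (n : ℝ) ^ 2 ≤ 30 * k ^ ((d : ℝ) / 2) :=
              div_le_self (by positivity) (one_le_pow₀ hn1)
            rw [hβ, sub_eq_add_neg, Real.exp_add, ← mul_assoc]
            exact mul_le_mul hnexp (Real.exp_le_exp.2 (neg_le_neg (hdiv.trans hexp)))
              (Real.exp_pos _).le (Real.exp_pos _).le
    · have h1 : 1 ≤ ε := one_le_pow₀ ((one_le_div hu0).2 hge)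
      have : bad X = ∅ := filter_eq_empty_iff.2 fun p _ => by
        have := abs_bias_le_one (fun x => MvPolynomial.eval x p.1) X
        linarith
      rw [this]
      simp only [card_empty, Nat.cast_zero]
      positivity
  set good : Finset (Poly n d) :=
    {p | IsExtractor (fun x => MvPolynomial.eval x p.1) (ε + ε') 𝒴} with hgood
  have hprob : probPoly n d (fun p => IsExtractor (fun x => MvPolynomial.eval x p) (ε + ε') 𝒴) =
      #good / Fintype.card (Poly n d) := by
    unfold probPoly
    rw [Nat.card_eq_fintype_card, Nat.card_eq_fintype_card, Fintype.card_subtype]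
  have hsub : goodᶜ ⊆ 𝒳.biUnion bad := by
    intro p hp
    by_contra hcon
    refine mem_compl.1 hp (mem_filter.2 ⟨mem_univ _, isExtractor_of_abs_bias_le h𝒴 ?_⟩)
    intro X hX
    by_contra! h
    exact hcon (mem_biUnion.2 ⟨X, hX, mem_filter.2 ⟨mem_univ _, h⟩⟩)
  have hcompl : (#goodᶜ : ℝ) ≤ #𝒳 * (Fintype.card (Poly n d) * β) := by
    calc (#goodᶜ : ℝ) ≤ ((∑ X ∈ 𝒳, #(bad X) : ℕ) : ℝ) := by
          exact_mod_cast (card_le_card hsub).trans card_biUnion_le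
      _ ≤ ∑ X ∈ 𝒳, Fintype.card (Poly n d) * β := by
          push_cast
          exact sum_le_sum hbad
      _ = _ := by rw [sum_const, nsmul_eq_mul]
  have hadd : (#good : ℝ) + #goodᶜ = Fintype.card (Poly n d) := by
    exact_mod_cast card_add_card_compl good
  rw [hprob, le_div_iff₀ hP]
  linarith

end LowDegreeExtractor

end

theorem mainTheorem6 :
    ∃ n₀ : ℕ, ∀ n : ℕ, n₀ ≤ n →
      ∀ k : ℝ, 5 * Real.logb 2 (n : ℝ) ≤ k →
      ∀ 𝒳 : Finset (PMF (LowDegreeExtractor.Cube n)),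
        (∀ X ∈ 𝒳, k ≤ LowDegreeExtractor.minEntropy X) →
      ∀ (ε' : ℝ) (𝒴 : Set (PMF (LowDegreeExtractor.Cube n))),
        (∀ Y ∈ 𝒴, ∃ Z : PMF (LowDegreeExtractor.Cube n),
          LowDegreeExtractor.IsConvexCombination (𝒳 : Set (PMF (LowDegreeExtractor.Cube n))) Z ∧
            LowDegreeExtractor.statDist Y Z ≤ ε') →
      ∀ d : ℕ, 6 ≤ d →
        1 - (𝒳.card : ℝ) *
            Real.exp (3 * (n : ℝ) - 30 * k ^ ((d : ℝ) / 2) / (n : ℝ) ^ 2) ≤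
          LowDegreeExtractor.probPoly n d (fun p =>
            LowDegreeExtractor.IsExtractor (fun x => MvPolynomial.eval x p)
              ((2 * (d : ℝ) / k ^ ((1 : ℝ) / 4)) ^ d + ε') 𝒴) := by
  -- From `n ≥ 2` on, `log n > 0` forces `k > 0`.
  exact ⟨2, fun n hn k hk 𝒳 h𝒳 ε' 𝒴 h𝒴 d hd =>
    LowDegreeExtractor.le_probPoly_isExtractor hn hk h𝒳 h𝒴 hd⟩
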